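/- **Corollary (plane wave expansion).** Let $n\ge 2$, let $(z\mid w)=\sum_{j=1}^n z_j\overline{w_j}$ and $|z|^2=(z\mid z)$ on $\mathbb C^n$, and let $S=\{z\in\mathbb C^n:|z|=1\}$. For integers $p,q\ge 0$ let $\mathcal H^{(p,q)}$ be the space of polynomials $P(z,\bar z)$ on $\mathbb C^n$ that are bihomogeneous of degree $(p,q)$, i.e. $P(\lambda z,\bar\lambda\bar z)=\lambda^p\bar\lambda^qP(z,\bar z)$ for all $\lambda\in\mathbb C$, $z\in\mathbb C^n$, and harmonic, i.e. annihilated by $\Delta=4\sum_j\partial^2/\partial z_j\partial\bar z_j$. For $\eta,\xi\in S$ and $\alpha=n-2$ let $Z^{(p,q)}_\eta(\xi)=W^{\alpha}_{p,q}((\xi\mid\eta))$, where, with $(a)_j=a(a+1)\cdots(a+j-1)$, $$W^\alpha_{p,q}(w)=\frac{(\alpha+1)_{p+q}}{(\alpha+1)_p(\alpha+1)_q}\,w^p\bar w^q\,{}_2F_1\Big(-p,-q;-\alpha-p-q;\tfrac1{|w|^2}\Big)=\frac{(\alpha+1)_{p+q}}{(\alpha+1)_p(\alpha+1)_q}\sum_{j=0}^{\min(p,q)}\frac{(-p)_j(-q)_j}{(-\alpha-p-q)_j\,j!}\,w^{p-j}\bar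 w^{q-j}$$ (the last expression also being used at $w=0$), and let $$J_\nu(r)=\Big(\frac r2\Big)^\nu\sum_{k=0}^\infty\frac{(-1)^k}{\Gamma(k+1)\Gamma(k+\nu+1)}\Big(\frac r2\Big)^{2k}$$ be the Bessel function of the first kind. Fix $\eta\in S$ and write $x\in\mathbb C^n$ as $x=|x|\xi$ with $\xi\in S$ (for $x=0$ the choice of $\xi$ is arbitrary). Then for every $x\ne0$ $$e^{i\,\mathrm{Re}(x\mid\eta)}=(n-1)!\Big(\frac{|x|}2\Big)^{-n+1}\sum_{p,q=0}^\infty i^{p+q}\,\dim\mathcal H^{(p,q)}\,J_{p+q+n-1}(|x|)\,Z^{(p,q)}_\eta(\xi),$$ and the series converges absolutely. If the factor $(|x|/2)^{-n+1}$ is taken inside the sum and the function $(|x|/2)^{-n+1}J_{p+q+n-1}(|x|)$ is given at $x=0$ its limit as $|x|\to0^+$, then the expansion holds for all $x\in\mathbb C^n$ including $x=0$, and both this series and the series of the absolute values of its terms converge uniformly in $x$ on every ball in $\mathbb C^n$ (the partial sums being taken over the finite sets of pairs $(p,q)$). -/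

import Mathlib

open Filter Topology

noncomputable section

namespace PlaneWave

/-- Polynomials `P(z, z̄)` on `ℂⁿ`: the variables `Sum.inl j` and `Sum.inr j` stand for `z_j` and
its conjugate. This is the algebra of complex polynomials on `ℝ²ⁿ` in complex coordinates. -/
abbrev Poly (n : ℕ) : Type := MvPolynomial (Fin n ⊕ Fin n) ℂ

/-- The value `P(z, z̄)` at a point `z` of `ℂⁿ`. -/
def evalAt {n : ℕ} (z : Fin n → ℂ) (P : Poly n) : ℂ :=
  MvPolynomial.eval (Sum.elim z (fun j => star (z j))) P

/-- The Euclidean Laplacian of `ℝ²ⁿ` in complex coordinates,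
`Δ = 4 ∑_j ∂²/∂z_j ∂z̄_j`. -/
def laplacian (n : ℕ) : Poly n →ₗ[ℂ] Poly n :=
  (4 : ℂ) • ∑ j : Fin n,
    (MvPolynomial.pderiv (R := ℂ) (Sum.inl j : Fin n ⊕ Fin n)).toLinearMap ∘ₗ
      (MvPolynomial.pderiv (R := ℂ) (Sum.inr j : Fin n ⊕ Fin n)).toLinearMap

/-- Bihomogeneous polynomials of bidegree `(p, q)`:
`P(cz, c̄z̄) = c^p c̄^q P(z, z̄)` for all `c ∈ ℂ` and `z ∈ ℂⁿ`. -/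
def bihomogeneous (n p q : ℕ) : Submodule ℂ (Poly n) where
  carrier := {P | ∀ (c : ℂ) (z : Fin n → ℂ),
    evalAt (fun j => c * z j) P = c ^ p * (star c) ^ q * evalAt z P}
  zero_mem' := by intro c z; simp [evalAt]
  add_mem' := by
    intro P Q hP hQ c z
    have h1 := hP c z
    have h2 := hQ c z
    simp only [evalAt, map_add] at h1 h2 ⊢
    rw [h1, h2]; ring
  smul_mem' := by
    intro a P hP c z
    have h1 := hP c z
    simp only [evalAt, MvPolynomial.smul_eval] at h1 ⊢
    rw [h1]; ring

/-- The space of solid harmonics of bidegree `(p, q)` on `ℂⁿ`. -/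
def solidHarmonics (n p q : ℕ) : Submodule ℂ (Poly n) :=
  LinearMap.ker (laplacian n) ⊓ bihomogeneous n p q

/-- The Pochhammer symbol `(a)_j = a (a + 1) ⋯ (a + j - 1)`. -/
def poch (a : ℂ) (j : ℕ) : ℂ := (ascPochhammer ℂ j).eval a

/-- The disc polynomial
`(α+1)_{p+q} / ((α+1)_p (α+1)_q) · w^p w̄^q ₂F₁(-p, -q; -α-p-q; 1/|w|²)`.
The hypergeometric series terminates at `j = min p q`; multiplied by `w^p w̄^q` its `j`-th term
contains `w^p w̄^q / |w|^{2j} = w^{p-j} w̄^{q-j}`, which makes sense at `w = 0` also. -/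
def discPolynomial (α : ℂ) (p q : ℕ) (w : ℂ) : ℂ :=
  poch (α + 1) (p + q) / (poch (α + 1) p * poch (α + 1) q) *
    ∑ j ∈ Finset.range (min p q + 1),
      poch (-(p : ℂ)) j * poch (-(q : ℂ)) j / (poch (-α - p - q) j * (j.factorial : ℂ)) *
        (w ^ (p - j) * (star w) ^ (q - j))

/-- The zonal harmonic of bidegree `(p, q)` with pole `η`, equal to `1` at the pole. Mathlib's
`inner ℂ η ξ` is `(ξ | η) = ∑_j ξ_j η̄_j`. -/
def zonalHarmonic {n : ℕ} (p q : ℕ) (η ξ : EuclideanSpace ℂ (Fin n)) : ℂ :=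
  discPolynomial ((n : ℂ) - 2) p q (inner ℂ η ξ)

/-- The Bessel function of the first kind of real order `ν`, for `r ≥ 0`. -/
def besselJ (ν r : ℝ) : ℝ :=
  (r / 2) ^ ν * ∑' k : ℕ,
    (-1) ^ k / (Real.Gamma (k + 1) * Real.Gamma (k + ν + 1)) * (r / 2) ^ (2 * k)

/-- The function `(r/2)^{-n+1} J_{l+n-1}(r)` of `r > 0`, extended to `r = 0` by its limit. -/
def besselCoeff (n l : ℕ) (r : ℝ) : ℝ :=
  Function.update (fun r : ℝ => (r / 2) ^ (-(n : ℤ) + 1) * besselJ ((l : ℝ) + n - 1) r) 0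
    (limUnder (𝓝[>] (0 : ℝ)) fun r : ℝ => (r / 2) ^ (-(n : ℤ) + 1) * besselJ ((l : ℝ) + n - 1) r) r

/-- The limit in the definition of `besselCoeff` exists. -/
theorem tendsto_besselCoeff {n : ℕ} (hn : 1 ≤ n) (l : ℕ) :
    Tendsto (fun r : ℝ => (r / 2) ^ (-(n : ℤ) + 1) * besselJ ((l : ℝ) + n - 1) r)
      (𝓝[>] (0 : ℝ)) (𝓝 (besselCoeff n l 0)) := by
  obtain ⟨m, rfl⟩ : ∃ m, n = m + 1 := ⟨n - 1, by omega⟩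
  have key : ∃ c : ℝ, Tendsto
      (fun r : ℝ => (r / 2) ^ (-((m + 1 : ℕ) : ℤ) + 1) * besselJ ((l : ℝ) + (m + 1 : ℕ) - 1) r)
      (𝓝[>] (0 : ℝ)) (𝓝 c) := by
    let F : ℝ → ℝ := fun r => (r / 2) ^ l * ∑' k : ℕ,
      (-1) ^ k / (Real.Gamma (k + 1) * Real.Gamma (k + ((l : ℝ) + (m + 1 : ℕ) - 1) + 1)) *
        (r / 2) ^ (2 * k)
    have hF : ContinuousOn F (Set.Icc (-2) 2) := by
      refine ContinuousOn.mul (by fun_prop) ?_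
      refine continuousOn_tsum (u := fun k : ℕ => 1 / (k.factorial : ℝ)) (fun k => by fun_prop)
        (by simpa using Real.summable_pow_div_factorial 1) ?_
      intro k r hr
      have e1 : Real.Gamma ((k : ℝ) + 1) = k.factorial := Real.Gamma_nat_eq_factorial k
      have e2 : Real.Gamma ((k : ℝ) + ((l : ℝ) + (m + 1 : ℕ) - 1) + 1) = (k + l + m).factorial := by
        rw [← Real.Gamma_nat_eq_factorial]; congr 1; push_cast; ring
      have hr2 : |r / 2| ≤ 1 := by
        rw [abs_le]; constructor <;> linarith [hr.1, hr.2]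
      rw [e1, e2, norm_mul, norm_div, norm_pow, norm_pow, norm_neg, norm_one, one_pow,
        norm_mul, Real.norm_eq_abs (r / 2)]
      simp only [Real.norm_natCast]
      have h1 : |r / 2| ^ (2 * k) ≤ 1 := pow_le_one₀ (abs_nonneg _) hr2
      have hp : (0 : ℝ) < k.factorial := by positivity
      have hq : (1 : ℝ) ≤ (k + l + m).factorial := by
        exact_mod_cast Nat.factorial_pos _
      calc 1 / ((k.factorial : ℝ) * (k + l + m).factorial) * |r / 2| ^ (2 * k)
          ≤ 1 / ((k.factorial : ℝ) * (k + l + m).factorial) * 1 := by gcongr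
        _ ≤ 1 / (k.factorial : ℝ) := by
            rw [mul_one]
            apply one_div_le_one_div_of_le hp
            nlinarith
    have hF0 : Tendsto F (𝓝[>] (0 : ℝ)) (𝓝 (F 0)) :=
      ((hF.continuousAt (Icc_mem_nhds (by norm_num) (by norm_num))).tendsto).mono_left
        nhdsWithin_le_nhds
    refine ⟨F 0, hF0.congr' ?_⟩
    filter_upwards [self_mem_nhdsWithin] with r hr
    have hr' : (0 : ℝ) < r / 2 := by
      have : (0 : ℝ) < r := hr
      linarith
    have e : (r / 2) ^ (-((m + 1 : ℕ) : ℤ) + 1) * (r / 2) ^ ((l : ℝ) + (m + 1 : ℕ) - 1)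
        = (r / 2) ^ l := by
      rw [← Real.rpow_intCast, ← Real.rpow_add hr', ← Real.rpow_natCast]
      congr 1; push_cast; ring
    simp only [F, besselJ]
    rw [← mul_assoc, e]
  simpa [besselCoeff] using tendsto_nhds_limUnder key

end PlaneWave

end

/-! Write n = m + 2, r = |x| and w = (ξ|η), so that |w| ≤ 1 and Re(x|η) = r(w + w̄)/2. Then e^{i
Re(x|η)} = e^{irw/2} e^{irw̄/2} is the sum over (a, b) of (ir/2)^{a+b} w^a w̄^b / (a! b!). Let
D_{p,q} be (m+1)! dim H^{(p,q)} times the disc polynomial. The finite identity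
`sum_scaledDiscPolynomial` says that w^a w̄^b / (a! b!) is the sum over k of D_{a-k,b-k}(w) / (k!
(a+b+m-k+1)!). Substituting it and putting p = a-k, q = b-k, the sum over k for fixed (p, q) is
i^{p+q} D_{p,q}(w) times the power series of (r/2)^{-n+1} J_{p+q+n-1}(r). No integration over the
sphere is needed. The dimension enters through rank-nullity, the Laplacian being surjective from
bidegree (p+1, q+1) to (p, q) (`map_laplacian_restrictSupport`). The rearrangement and the uniform
convergence rest on |D_{p,q}(w)| / (p+q+m+1)! ≤ (2^p/p!)(2^q/q!)
(`norm_scaledDiscPolynomial_div_le`). -/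

namespace PlaneWave

/-! ### Bihomogeneous polynomials as spans of monomials -/

open MvPolynomial

/-- A polynomial in `z` and `z̄` that vanishes at every point of `ℂⁿ` is zero. -/
theorem eq_zero_of_forall_evalAt_eq_zero {n : ℕ} {P : Poly n} (h : ∀ z, evalAt z P = 0) :
    P = 0 := by
  -- The substitution z = x + iy, z̄ = x - iy gives a polynomial in the real coordinates; it
  -- vanishes at all real points, hence identically.
  set f : Fin n ⊕ Fin n → Poly n := Sum.elim
    (fun j => X (Sum.inl j) + C Complex.I * X (Sum.inr j))
    (fun j => X (Sum.inl j) - C Complex.I * X (Sum.inr j)) with hf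
  have hQ : ∀ v : Fin n ⊕ Fin n → ℂ, eval v (bind₁ f P) = eval (fun i => eval v (f i)) P := by
    intro v
    rw [← MvPolynomial.coe_aeval_eq_eval, RingHom.coe_coe, aeval_bind₁,
      ← MvPolynomial.coe_aeval_eq_eval, RingHom.coe_coe]
  have hzero : bind₁ f P = 0 := by
    refine funext_set (fun _ => Set.range (Complex.ofReal))
      (fun _ => Set.infinite_range_of_injective Complex.ofReal_injective) fun v hv => ?_
    rw [hQ, map_zero]
    have hr : ∀ i, star (v i) = v i := by
      intro i
      obtain ⟨a, ha⟩ := hv i (Set.mem_univ i)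
      rw [← ha]; exact Complex.conj_ofReal a
    have := h (fun j => v (Sum.inl j) + Complex.I * v (Sum.inr j))
    rw [evalAt] at this
    convert this using 2
    congr 1
    ext i
    rcases i with j | j
    · simp [hf]
    · have e1 := hr (Sum.inl j)
      have e2 := hr (Sum.inr j)
      simp only [RCLike.star_def] at e1 e2
      simp [hf, e1, e2]
      ring
  -- The substitution is invertible over ℂ, so every complex point u is the image of some (x, y),
  -- now with complex entries.
  apply MvPolynomial.funext
  intro u
  have := hQ (Sum.elim (fun j => (u (Sum.inl j) + u (Sum.inr j)) / 2)
    (fun j => (u (Sum.inl j) - u (Sum.inr j)) / (2 * Complex.I)))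
  rw [hzero, map_zero] at this
  rw [map_zero, this]
  congr 1
  congr 1
  ext i
  rcases i with j | j
  · simp [hf]; field_simp; ring
  · simp [hf]; field_simp; ring

/-- The exponents of the monomials of bidegree `(p, q)`. -/
def bidegreeExponents (n p q : ℕ) : Set (Fin n ⊕ Fin n →₀ ℕ) :=
  {s | ∑ j, s (Sum.inl j) = p ∧ ∑ j, s (Sum.inr j) = q}

/-- Multiplication of `z` by a scalar, on polynomials. -/
noncomputable def dilate {n : ℕ} (c : ℂ) : Poly n →ₐ[ℂ] Poly n :=
  aeval (Sum.elim (fun j => C c * X (Sum.inl j)) (fun j => C (star c) * X (Sum.inr j)))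

theorem evalAt_dilate {n : ℕ} (c : ℂ) (z : Fin n → ℂ) (P : Poly n) :
    evalAt z (dilate c P) = evalAt (fun j => c * z j) P := by
  induction P using MvPolynomial.induction_on with
  | C a => simp [evalAt, dilate]
  | add P Q hP hQ => simp only [evalAt, map_add] at *; rw [hP, hQ]
  | mul_X P i hP =>
    simp only [evalAt, map_mul] at *
    rw [hP]
    rcases i with j | j <;> simp [dilate]

theorem dilate_monomial {n : ℕ} (c : ℂ) (s : Fin n ⊕ Fin n →₀ ℕ) (a : ℂ) :
    dilate c (monomial s a) =
      (c ^ (∑ j, s (Sum.inl j)) * star c ^ (∑ j, s (Sum.inr j))) • monomial s a := by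
  rw [dilate, aeval_monomial, Finsupp.prod_fintype _ _ (by simp), monomial_eq,
    Finsupp.prod_fintype _ _ (by simp)]
  simp only [Fintype.prod_sum_type, Sum.elim_inl, Sum.elim_inr, mul_pow, Finset.prod_mul_distrib,
    Finset.prod_pow_eq_pow_sum, smul_eq_C_mul, map_mul, map_pow, algebraMap_eq]
  ring

theorem coeff_dilate {n : ℕ} (c : ℂ) (P : Poly n) (s : Fin n ⊕ Fin n →₀ ℕ) :
    coeff s (dilate c P) =
      c ^ (∑ j, s (Sum.inl j)) * star c ^ (∑ j, s (Sum.inr j)) * coeff s P := by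
  induction P using MvPolynomial.induction_on' with
  | monomial t a =>
    rw [dilate_monomial, coeff_smul, coeff_monomial, smul_eq_mul]
    split_ifs with h
    · rw [h]
    · simp
  | add P Q hP hQ => rw [map_add, coeff_add, coeff_add, hP, hQ, mul_add]

theorem mem_bihomogeneous_iff_dilate {n p q : ℕ} {P : Poly n} :
    P ∈ bihomogeneous n p q ↔ ∀ c : ℂ, dilate c P = (c ^ p * star c ^ q) • P := by
  constructor
  · intro h c
    rw [← sub_eq_zero]
    refine eq_zero_of_forall_evalAt_eq_zero fun z => ?_
    have h1 := evalAt_dilate c z P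
    have h2 := h c z
    simp only [evalAt, map_sub, smul_eval] at h1 h2 ⊢
    rw [h1, h2, sub_self]
  · intro h c z
    rw [← evalAt_dilate, h c]
    simp only [evalAt, smul_eval]

/-- The two sides are monomials in one variable z and z̄; agreeing at every point, they are equal as
polynomials. -/
theorem exponents_eq_of_forall_pow_mul_star_pow_eq {a b p q : ℕ}
    (h : ∀ c : ℂ, c ^ a * star c ^ b = c ^ p * star c ^ q) : a = p ∧ b = q := by
  have key : monomial (Finsupp.single (Sum.inl 0) a + Finsupp.single (Sum.inr 0) b) 1 -
      monomial (Finsupp.single (Sum.inl 0) p + Finsupp.single (Sum.inr 0) q) 1 =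
        (0 : Poly 1) := by
    refine eq_zero_of_forall_evalAt_eq_zero fun z => ?_
    have hz := h (z 0)
    simp only [RCLike.star_def] at hz
    simp [evalAt, monomial_single_add, eval_monomial, hz]
  have := monomial_left_injective (one_ne_zero (α := ℂ)) (sub_eq_zero.1 key)
  constructor
  · simpa using DFunLike.congr_fun this (Sum.inl 0)
  · simpa using DFunLike.congr_fun this (Sum.inr 0)

/-- Dilations act diagonally on monomials, so the condition can be read off coefficient by
coefficient. -/
theorem bihomogeneous_eq_restrictSupport (n p q : ℕ) :
    bihomogeneous n p q = restrictSupport ℂ (bidegreeExponents n p q) := by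
  ext P
  rw [mem_bihomogeneous_iff_dilate, mem_restrictSupport_iff]
  constructor
  · intro h s hs
    refine exponents_eq_of_forall_pow_mul_star_pow_eq fun c => ?_
    have := congrArg (coeff s) (h c)
    rw [coeff_dilate, coeff_smul, smul_eq_mul] at this
    exact mul_right_cancel₀ (mem_support_iff.1 hs) this
  · intro h c
    ext s
    rw [coeff_dilate, coeff_smul, smul_eq_mul]
    by_cases hs : coeff s P = 0
    · rw [hs, mul_zero, mul_zero]
    · obtain ⟨h1, h2⟩ := h (mem_support_iff.2 hs)
      rw [h1, h2]

/-- Exponents of bidegree `(p, q)` are pairs of weak compositions of `p` and `q`. -/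
theorem card_bidegreeExponents (n p q : ℕ) :
    Nat.card (bidegreeExponents n p q) = (n + p - 1).choose p * (n + q - 1).choose q := by
  have e : bidegreeExponents n p q ≃ (Finset.univ : Finset (Fin n)).finsuppAntidiag p ×
      (Finset.univ : Finset (Fin n)).finsuppAntidiag q :=
    (Finsupp.sumFinsuppEquivProdFinsupp.subtypeEquiv (q := fun t =>
      t.1 ∈ (Finset.univ : Finset (Fin n)).finsuppAntidiag p ∧
      t.2 ∈ (Finset.univ : Finset (Fin n)).finsuppAntidiag q) (fun s => by
        simp [bidegreeExponents, Finset.mem_finsuppAntidiag]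
        rfl)).trans
      Equiv.subtypeProdEquivProd
  rw [Nat.card_congr e, Nat.card_prod, Nat.card_eq_fintype_card, Nat.card_eq_fintype_card,
    Fintype.card_coe, Fintype.card_coe, Finset.card_finsuppAntidiag_nat_eq_choose,
    Finset.card_finsuppAntidiag_nat_eq_choose, Finset.card_univ, Fintype.card_fin]

end PlaneWave

/-! ### Surjectivity of the Laplacian and the dimension of the harmonics -/

namespace PlaneWave

open MvPolynomial

theorem laplacian_monomial {n : ℕ} (s : Fin n ⊕ Fin n →₀ ℕ) (a : ℂ) :
    laplacian n (monomial s a) = (4 : ℂ) • ∑ j, monomial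
      (s - Finsupp.single (Sum.inr j) 1 - Finsupp.single (Sum.inl j) 1)
      (a * s (Sum.inr j) * s (Sum.inl j)) := by
  simp [laplacian, pderiv_monomial]

theorem mem_bidegreeExponents_of_add_single {n p q : ℕ} {s t : Fin n ⊕ Fin n →₀ ℕ} {i j : Fin n}
    (hs : s ∈ bidegreeExponents n p q)
    (h : t + Finsupp.single (Sum.inl j) 1 + Finsupp.single (Sum.inr j) 1 =
      s + Finsupp.single (Sum.inl i) 1 + Finsupp.single (Sum.inr i) 1) :
    t ∈ bidegreeExponents n p q := by
  have hl := congrArg (fun u : Fin n ⊕ Fin n →₀ ℕ => ∑ j, u (Sum.inl j)) h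
  have hr := congrArg (fun u : Fin n ⊕ Fin n →₀ ℕ => ∑ j, u (Sum.inr j)) h
  simp [Finset.sum_add_distrib, Finsupp.single_apply] at hl hr
  exact ⟨hl.trans hs.1, hr.trans hs.2⟩

theorem add_single_mem_bidegreeExponents {n p q : ℕ} {s : Fin n ⊕ Fin n →₀ ℕ} (j : Fin n)
    (hs : s ∈ bidegreeExponents n p q) :
    s + Finsupp.single (Sum.inl j) 1 + Finsupp.single (Sum.inr j) 1 ∈
      bidegreeExponents n (p + 1) (q + 1) := by
  constructor <;> simp [Finset.sum_add_distrib, Finsupp.single_apply, hs.1, hs.2]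

theorem sub_single_add_single {n : ℕ} {s : Fin n ⊕ Fin n →₀ ℕ} {j : Fin n}
    (hl : s (Sum.inl j) ≠ 0) (hr : s (Sum.inr j) ≠ 0) :
    s - Finsupp.single (Sum.inr j) 1 - Finsupp.single (Sum.inl j) 1 +
      Finsupp.single (Sum.inl j) 1 + Finsupp.single (Sum.inr j) 1 = s := by
  ext i
  simp only [Finsupp.add_apply, Finsupp.tsub_apply, Finsupp.single_apply]
  rcases i with i | i <;> by_cases h : j = i <;> simp [h] <;> subst h <;> omega

/-- The Laplacian maps `P^{(p+1,q+1)}` into `P^{(p,q)}`. -/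
theorem laplacian_mem_restrictSupport {n p q : ℕ} {P : Poly n}
    (hP : P ∈ restrictSupport ℂ (bidegreeExponents n (p + 1) (q + 1))) :
    laplacian n P ∈ restrictSupport ℂ (bidegreeExponents n p q) := by
  rw [P.as_sum, map_sum]
  refine Submodule.sum_mem _ fun s hs => ?_
  rw [laplacian_monomial]
  refine Submodule.smul_mem _ _ (Submodule.sum_mem _ fun j _ => ?_)
  rw [monomial_mem_restrictSupport, or_iff_not_imp_right]
  intro h
  simp only [mul_eq_zero, not_or, Nat.cast_eq_zero] at h
  have e := sub_single_add_single h.2 h.1.2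
  have hs' := hP hs
  generalize s - Finsupp.single (Sum.inr j) 1 - Finsupp.single (Sum.inl j) 1 = t at e
  rw [← e] at hs'
  obtain ⟨h1, h2⟩ := hs'
  simp [Finset.sum_add_distrib, Finsupp.single_apply] at h1 h2
  exact ⟨h1, h2⟩

theorem laplacian_eq_zero_of_mem {n p q : ℕ} (h : p = 0 ∨ q = 0) {P : Poly n}
    (hP : P ∈ restrictSupport ℂ (bidegreeExponents n p q)) : laplacian n P = 0 := by
  rw [P.as_sum, map_sum]
  refine Finset.sum_eq_zero fun s hs => ?_
  rw [laplacian_monomial]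
  obtain ⟨h1, h2⟩ := hP hs
  rw [Finset.sum_eq_zero, smul_zero]
  intro j _
  rcases h with rfl | rfl
  · rw [(Finset.sum_eq_zero_iff.1 h1) j (Finset.mem_univ j)]; simp
  · rw [(Finset.sum_eq_zero_iff.1 h2) j (Finset.mem_univ j)]; simp

/-- The Laplacian of z_i z̄_i times the monomial is a nonzero multiple of that monomial plus
monomials of the same bidegree with one more factor z_i. Induction on p minus the exponent of z_i
disposes of the latter. -/
theorem monomial_mem_map_laplacian {n p q : ℕ} (i : Fin n) (a : ℂ) (k : ℕ) :
    ∀ s ∈ bidegreeExponents n p q, p - s (Sum.inl i) = k → monomial s a ∈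
      (restrictSupport ℂ (bidegreeExponents n (p + 1) (q + 1))).map (laplacian n) := by
  induction k using Nat.strong_induction_on generalizing a with
  | _ k ih =>
  intro s hs hk
  set V := (restrictSupport ℂ (bidegreeExponents n (p + 1) (q + 1))).map (laplacian n) with hV
  set t := s + Finsupp.single (Sum.inl i) 1 + Finsupp.single (Sum.inr i) 1 with ht
  have hΔ : laplacian n (monomial t a) ∈ V :=
    Submodule.mem_map_of_mem
      ((monomial_mem_restrictSupport ℂ).2 (Or.inl (add_single_mem_bidegreeExponents i hs)))
  rw [laplacian_monomial, Submodule.smul_mem_iff _ (by norm_num : (4 : ℂ) ≠ 0),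
    ← Finset.add_sum_erase _ _ (Finset.mem_univ i), Submodule.add_mem_iff_left] at hΔ
  · have e : t - Finsupp.single (Sum.inr i) 1 - Finsupp.single (Sum.inl i) 1 = s := by
      rw [ht, add_tsub_cancel_right, add_tsub_cancel_right]
    have e1 : t (Sum.inr i) = s (Sum.inr i) + 1 := by simp [ht]
    have e2 : t (Sum.inl i) = s (Sum.inl i) + 1 := by simp [ht]
    rw [e, e1, e2, show a * ((s (Sum.inr i) + 1 : ℕ) : ℂ) * ((s (Sum.inl i) + 1 : ℕ) : ℂ) =
      (((s (Sum.inr i) + 1 : ℕ) : ℂ) * ((s (Sum.inl i) + 1 : ℕ) : ℂ)) • a by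
        rw [smul_eq_mul]; ring, ← smul_monomial, Submodule.smul_mem_iff] at hΔ
    · exact hΔ
    · exact mul_ne_zero (Nat.cast_ne_zero.2 (Nat.succ_ne_zero _))
        (Nat.cast_ne_zero.2 (Nat.succ_ne_zero _))
  · refine Submodule.sum_mem _ fun j hj => ?_
    have hji : j ≠ i := (Finset.mem_erase.1 hj).1
    by_cases h : t (Sum.inl j) = 0 ∨ t (Sum.inr j) = 0
    · rcases h with h | h <;> simp [h]
    rw [not_or] at h
    have e := sub_single_add_single h.1 h.2
    have hmem := mem_bidegreeExponents_of_add_single hs e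
    refine ih _ ?_ _ _ hmem rfl
    have h1 : (t - Finsupp.single (Sum.inr j) 1 - Finsupp.single (Sum.inl j) 1 :
        Fin n ⊕ Fin n →₀ ℕ) (Sum.inl i) =
        s (Sum.inl i) + 1 := by
      simp [ht, hji]
    -- The new exponent of z_i is still at most p, so the truncated difference really drops.
    have h2 := Finset.single_le_sum (f := fun l =>
      (t - Finsupp.single (Sum.inr j) 1 - Finsupp.single (Sum.inl j) 1 :
        Fin n ⊕ Fin n →₀ ℕ) (Sum.inl l))
      (fun _ _ => Nat.zero_le _) (Finset.mem_univ i)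
    rw [hmem.1] at h2
    simp only [h1] at h2 ⊢
    omega

theorem map_laplacian_restrictSupport {n : ℕ} (hn : 1 ≤ n) (p q : ℕ) :
    (restrictSupport ℂ (bidegreeExponents n (p + 1) (q + 1))).map (laplacian n) =
      restrictSupport ℂ (bidegreeExponents n p q) := by
  apply le_antisymm
  · rw [Submodule.map_le_iff_le_comap]
    exact fun P hP => laplacian_mem_restrictSupport hP
  · rw [restrictSupport_eq_span, Submodule.span_le]
    rintro _ ⟨s, hs, rfl⟩
    exact monomial_mem_map_laplacian ⟨0, hn⟩ 1 _ s hs rfl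

theorem finite_bidegreeExponents {n : ℕ} (hn : 1 ≤ n) (p q : ℕ) :
    (bidegreeExponents n p q).Finite := by
  refine Nat.finite_of_card_ne_zero ?_
  rw [card_bidegreeExponents]
  exact (Nat.mul_pos (Nat.choose_pos (by omega)) (Nat.choose_pos (by omega))).ne'

theorem finrank_restrictSupport_bidegreeExponents (n p q : ℕ) :
    Module.finrank ℂ (restrictSupport ℂ (bidegreeExponents n p q)) =
      (n + p - 1).choose p * (n + q - 1).choose q := by
  rw [Module.finrank_eq_nat_card_basis (basisRestrictSupport ℂ _), card_bidegreeExponents]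

/-- Rank-nullity for the surjective Laplacian, stated additively to avoid subtraction in ℕ. -/
theorem finrank_solidHarmonics_add {n : ℕ} (hn : 1 ≤ n) (p q : ℕ) :
    Module.finrank ℂ (solidHarmonics n (p + 1) (q + 1)) +
      (n + p - 1).choose p * (n + q - 1).choose q =
      (n + p).choose (p + 1) * (n + q).choose (q + 1) := by
  set W := restrictSupport ℂ (bidegreeExponents n (p + 1) (q + 1)) with hW
  have : Finite (bidegreeExponents n (p + 1) (q + 1)) := finite_bidegreeExponents hn _ _
  have : FiniteDimensional ℂ W := (basisRestrictSupport ℂ _).finiteDimensional_of_finite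
  have h := LinearMap.finrank_range_add_finrank_ker ((laplacian n).domRestrict W)
  rw [LinearMap.range_domRestrict, LinearMap.ker_domRestrict, map_laplacian_restrictSupport hn,
    finrank_restrictSupport_bidegreeExponents, finrank_restrictSupport_bidegreeExponents] at h
  have e : solidHarmonics n (p + 1) (q + 1) =
      ((LinearMap.ker (laplacian n)).comap W.subtype).map W.subtype := by
    rw [Submodule.map_comap_subtype, solidHarmonics, bihomogeneous_eq_restrictSupport, inf_comm]
  rw [e, Submodule.finrank_map_subtype_eq, add_comm, h]
  rfl

theorem finrank_solidHarmonics_of_eq_zero {n p q : ℕ} (h : p = 0 ∨ q = 0) :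
    Module.finrank ℂ (solidHarmonics n p q) =
      (n + p - 1).choose p * (n + q - 1).choose q := by
  rw [← finrank_restrictSupport_bidegreeExponents, solidHarmonics,
    bihomogeneous_eq_restrictSupport, inf_eq_right.2]
  exact fun P hP => LinearMap.mem_ker.2 (laplacian_eq_zero_of_mem h hP)

/-- The dimension of the space of solid harmonics of bidegree `(p, q)` on `ℂ^{m+2}`. -/
theorem finrank_solidHarmonics_mul (m p q : ℕ) :
    Module.finrank ℂ (solidHarmonics (m + 2) p q) *
      (p.factorial * q.factorial * (m + 1).factorial * m.factorial) =
      (p + q + m + 1) * (p + m).factorial * (q + m).factorial := by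
  have hc : ∀ k : ℕ, (((m + 1 + k).choose k : ℕ) : ℤ) * (k.factorial * (m + 1).factorial) =
      (m + 1 + k) * (k + m).factorial := fun k => by
    have h1 := Nat.add_choose_mul_factorial_mul_factorial (m + 1) k
    have h2 : (m + 1 + k).factorial = (m + 1 + k) * (k + m).factorial := by
      rw [show m + 1 + k = k + m + 1 by ring, Nat.factorial_succ]
    rw [h2] at h1
    zify at h1
    linear_combination h1
  have hm : ((m + 1).factorial : ℤ) = (m + 1) * m.factorial := by
    rw [Nat.factorial_succ]; push_cast; ring
  have hm0 : ((m : ℤ) + 1) ≠ 0 := by positivity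
  zify
  -- The extra factor turns (m+1)! m! into (m+1)!², the denominator of a product of two binomials in
  -- `hc`.
  apply mul_left_cancel₀ hm0
  by_cases h : p = 0 ∨ q = 0
  · have hp := hc p
    have hq := hc q
    rw [finrank_solidHarmonics_of_eq_zero h, show m + 2 + p - 1 = m + 1 + p by omega,
      show m + 2 + q - 1 = m + 1 + q by omega]
    -- Needed because (p+m+1)(q+m+1) and (m+1)(p+q+m+1) differ by pq.
    have hpq : (p : ℤ) * q = 0 := by rcases h with rfl | rfl <;> simp
    rw [hm] at hp hq
    push_cast [hm] at hp hq ⊢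
    linear_combination
      (((m + 1 + q).choose q : ℕ) : ℤ) * (q.factorial * ((m + 1) * m.factorial)) * hp +
      (m + 1 + p) * (p + m).factorial * hq + (p + m).factorial * (q + m).factorial * hpq
  · obtain ⟨p, rfl⟩ : ∃ k, p = k + 1 := ⟨p - 1, by omega⟩
    obtain ⟨q, rfl⟩ : ∃ k, q = k + 1 := ⟨q - 1, by omega⟩
    have hd := finrank_solidHarmonics_add (n := m + 2) (by omega) p q
    rw [show m + 2 + p - 1 = m + 1 + p by omega, show m + 2 + q - 1 = m + 1 + q by omega,
      show m + 2 + p = m + 1 + (p + 1) by omega, show m + 2 + q = m + 1 + (q + 1) by omega] at hd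
    zify at hd
    have hp := hc p
    have hq := hc q
    have hp' := hc (p + 1)
    have hq' := hc (q + 1)
    have ep : ((p + 1 + m).factorial : ℤ) = (p + m + 1) * (p + m).factorial := by
      rw [show p + 1 + m = p + m + 1 by ring, Nat.factorial_succ]; push_cast; ring
    have eq : ((q + 1 + m).factorial : ℤ) = (q + m + 1) * (q + m).factorial := by
      rw [show q + 1 + m = q + m + 1 by ring, Nat.factorial_succ]; push_cast; ring
    have fp : ((p + 1).factorial : ℤ) = (p + 1) * p.factorial := by
      rw [Nat.factorial_succ]; push_cast; ring
    have fq : ((q + 1).factorial : ℤ) = (q + 1) * q.factorial := by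
      rw [Nat.factorial_succ]; push_cast; ring
    rw [ep] at hp' ⊢
    rw [eq] at hq' ⊢
    rw [fp] at hp' ⊢
    rw [fq] at hq' ⊢
    push_cast at hp hq hp' hq' hd ⊢
    generalize (((m + 1 + p).choose p : ℕ) : ℤ) = A at *
    generalize (((m + 1 + q).choose q : ℕ) : ℤ) = B at *
    generalize (((m + 1 + (p + 1)).choose (p + 1) : ℕ) : ℤ) = A' at *
    generalize (((m + 1 + (q + 1)).choose (q + 1) : ℕ) : ℤ) = B' at *
    rw [hm] at *
    generalize (p.factorial : ℤ) = P at *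
    generalize (q.factorial : ℤ) = Q at *
    generalize ((p + m).factorial : ℤ) = X at *
    generalize ((q + m).factorial : ℤ) = Y at *
    generalize (m.factorial : ℤ) = M at *
    linear_combination ((p + 1) * (q + 1) * P * Q * ((m + 1) * M) ^ 2) * hd
      + (B' * ((q + 1) * Q * ((m + 1) * M))) * hp' +
        ((m + 1 + (p + 1)) * ((p + m + 1) * X)) * hq'
      - (p + 1) * (q + 1) * (B * (Q * ((m + 1) * M))) * hp
      - (p + 1) * (q + 1) * ((m + 1 + p) * X) * hq

end PlaneWave

/-! ### Disc polynomials: expansion of monomials and bounds -/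

namespace PlaneWave

open Finset

theorem poch_neg_natCast_mul {N j : ℕ} (h : j ≤ N) :
    poch (-(N : ℂ)) j * (N - j).factorial = (-1) ^ j * N.factorial := by
  have h1 := ascPochhammer_eval_neg_eq_descPochhammer (R := ℂ) N j
  rw [descPochhammer_eval_eq_descFactorial] at h1
  rw [poch, h1, ← Nat.factorial_mul_descFactorial h]
  push_cast; ring

theorem poch_natCast_add_one_mul (m j : ℕ) :
    poch ((m : ℂ) + 1) j * m.factorial = (j + m).factorial := by
  have h1 := ascPochhammer_nat_eq_ascFactorial (m + 1) j
  have h2 := congrArg (Nat.cast : ℕ → ℂ) h1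
  rw [ascPochhammer_eval_cast] at h2
  push_cast at h2
  rw [poch, h2, add_comm j m, ← Nat.factorial_mul_ascFactorial]
  push_cast; ring

/-- The disc polynomial with `α = m`, multiplied by the dimension of the space of solid harmonics of
bidegree `(p, q)` on `ℂ^{m+2}` and by `(m + 1)!`. -/
noncomputable def scaledDiscPolynomial (m p q : ℕ) (w : ℂ) : ℂ :=
  ∑ j ∈ range (min p q + 1), ((p : ℂ) + q + m + 1) * ((-1) ^ j * (p + q + m - j).factorial /
    ((p - j).factorial * (q - j).factorial * j.factorial)) * (w ^ (p - j) * star w ^ (q - j))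

/-- The dimension cancels the (p+m)! (q+m)! of the normalising constant. Three Pochhammer symbols at
negative integers leave one sign (-1)^j. -/
theorem factorial_mul_finrank_mul_discPolynomial (m p q : ℕ) (w : ℂ) :
    ((m + 1).factorial : ℂ) * Module.finrank ℂ (solidHarmonics (m + 2) p q) *
      discPolynomial m p q w = scaledDiscPolynomial m p q w := by
  rw [discPolynomial, scaledDiscPolynomial, ← mul_assoc, mul_sum]
  refine sum_congr rfl fun j hj => ?_
  have hj' : j ≤ p ∧ j ≤ q := by
    rw [mem_range] at hj; omega
  rw [← mul_assoc]
  congr 1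
  have h0 : ∀ k : ℕ, (k.factorial : ℂ) ≠ 0 := fun k => Nat.cast_ne_zero.2 k.factorial_ne_zero
  have hd := congrArg (Nat.cast : ℕ → ℂ) (finrank_solidHarmonics_mul m p q)
  push_cast at hd
  rw [← eq_div_iff (by simp [h0])] at hd
  have e1 := poch_natCast_add_one_mul m (p + q)
  have e2 := poch_natCast_add_one_mul m p
  have e3 := poch_natCast_add_one_mul m q
  have e4 := poch_neg_natCast_mul hj'.1
  have e5 := poch_neg_natCast_mul hj'.2
  have e6 := poch_neg_natCast_mul (show j ≤ p + q + m by omega)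
  rw [show (-((p + q + m : ℕ) : ℂ)) = -(m : ℂ) - p - q by push_cast; ring] at e6
  rw [← eq_div_iff (h0 _)] at e1 e2 e3 e4 e5 e6
  rw [hd, e1, e2, e3, e4, e5, e6]
  have := h0 m
  have := h0 (m + 1)
  have := h0 p
  have := h0 q
  have := h0 j
  have := h0 (p + m)
  have := h0 (q + m)
  have := h0 (p + q + m)
  have := h0 (p - j)
  have := h0 (q - j)
  have := h0 (p + q + m - j)
  have hs : ((-1 : ℂ) ^ j) ≠ 0 := pow_ne_zero _ (by norm_num)
  field_simp

/-- Closed form of the partial sums, making the next vanishing sum telescope. -/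
theorem sum_range_succ_alternating_eq {l M : ℕ} (hM : 2 * l ≤ M) (k : ℕ) (hk : k + 1 ≤ l) :
    ∑ i ∈ range (k + 1), ((M : ℂ) - 2 * i + 1) * ((-1) ^ (l - i) * (M - i - l).factorial /
      (i.factorial * (l - i).factorial * (M - i + 1).factorial)) =
    (-1) ^ (l - k) * (M - k - l).factorial /
      (l * k.factorial * (l - k - 1).factorial * (M - k).factorial) := by
  have h0 : ∀ k : ℕ, (k.factorial : ℂ) ≠ 0 := fun k => Nat.cast_ne_zero.2 k.factorial_ne_zero
  have hs : ∀ k : ℕ, ((k : ℂ) + 1) ≠ 0 := fun k => Nat.cast_add_one_ne_zero k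
  induction k with
  | zero =>
    obtain ⟨l, rfl⟩ : ∃ r, l = r + 1 := ⟨l - 1, by omega⟩
    have := h0 l
    have := hs l
    have := hs M
    have := h0 M
    simp [Nat.factorial_succ]
    field_simp
  | succ k ih =>
    rw [sum_range_succ, ih (by omega)]
    obtain ⟨r, rfl⟩ : ∃ r, l = k + 2 + r := ⟨l - (k + 2), by omega⟩
    obtain ⟨s, rfl⟩ : ∃ s, M = 2 * (k + 2 + r) + s := ⟨M - 2 * (k + 2 + r), by omega⟩
    rw [show k + 2 + r - k = r + 2 by omega, show k + 2 + r - (k + 1) = r + 1 by omega,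
      show 2 * (k + 2 + r) + s - k - (k + 2 + r) = r + s + 2 by omega,
      show 2 * (k + 2 + r) + s - (k + 1) - (k + 2 + r) = r + s + 1 by omega,
      show 2 * (k + 2 + r) + s - k = k + 2 * r + s + 3 + 1 by omega,
      show 2 * (k + 2 + r) + s - (k + 1) = k + 2 * r + s + 3 by omega,
      show r + 2 - 1 = r + 1 by omega, show r + 1 - 1 = r by omega,
      Nat.factorial_succ (r + s + 1), Nat.factorial_succ (k + 2 * r + s + 3),
      Nat.factorial_succ k, Nat.factorial_succ r]
    have h1 := h0 r
    have h2 := h0 k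
    have h3 := h0 (r + s + 1)
    have h4 := h0 (k + 2 * r + s + 3)
    have h5 := hs r
    have h6 := hs k
    have h7 := hs (k + 2 * r + s + 3)
    have h8 := hs (k + 1 + r)
    push_cast at *
    have h9 : (k : ℂ) + 2 + r ≠ 0 := by convert h8 using 1; ring
    have h10 : (k : ℂ) + r * 2 + s + 3 + 1 ≠ 0 := by convert h7 using 1; ring
    field_simp
    ring

/-- The partial sum up to l - 1 is the negative of the term i = l. -/
theorem sum_alternating_eq_zero {l M : ℕ} (hl : l ≠ 0) (hM : 2 * l ≤ M) :
    ∑ i ∈ range (l + 1), ((M : ℂ) - 2 * i + 1) * ((-1) ^ (l - i) * (M - i - l).factorial /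
      (i.factorial * (l - i).factorial * (M - i + 1).factorial)) = 0 := by
  obtain ⟨l, rfl⟩ : ∃ r, l = r + 1 := ⟨l - 1, by omega⟩
  obtain ⟨s, rfl⟩ : ∃ s, M = 2 * (l + 1) + s := ⟨M - 2 * (l + 1), by omega⟩
  have h0 : ∀ k : ℕ, (k.factorial : ℂ) ≠ 0 := fun k => Nat.cast_ne_zero.2 k.factorial_ne_zero
  have hs : ∀ k : ℕ, ((k : ℂ) + 1) ≠ 0 := fun k => Nat.cast_add_one_ne_zero k
  rw [sum_range_succ, sum_range_succ_alternating_eq hM l le_rfl,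
    show l + 1 - l = 1 by omega, show 1 - 1 = 0 by omega, show l + 1 - (l + 1) = 0 by omega,
    show 2 * (l + 1) + s - l - (l + 1) = s + 1 by omega,
    show 2 * (l + 1) + s - (l + 1) - (l + 1) = s by omega,
    show 2 * (l + 1) + s - l = l + s + 2 by omega,
    show 2 * (l + 1) + s - (l + 1) + 1 = l + s + 2 by omega, Nat.factorial_succ s,
    Nat.factorial_succ l]
  have h1 := h0 l
  have h2 := h0 s
  have h3 := h0 (l + s + 2)
  have h4 := hs l
  have h5 := hs s
  push_cast at *
  field_simp
  ring

/-- The expansion of a monomial in disc polynomials. -/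
theorem sum_scaledDiscPolynomial (m a b : ℕ) (w : ℂ) :
    ∑ k ∈ range (min a b + 1), scaledDiscPolynomial m (a - k) (b - k) w /
      (k.factorial * (a + b + m - k + 1).factorial) =
    w ^ a * star w ^ b / (a.factorial * b.factorial) := by
  set L := min a b with hL
  let f : ℕ → ℕ → ℂ := fun k j => ((a + b + m : ℕ) - 2 * (k : ℂ) + 1) *
    ((-1) ^ j * (a + b + m - k - (k + j)).factorial /
      (k.factorial * j.factorial * (a + b + m - k + 1).factorial)) *
    (w ^ (a - (k + j)) * star w ^ (b - (k + j)) /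
      ((a - (k + j)).factorial * (b - (k + j)).factorial))
  have h1 : ∀ k ∈ range (L + 1), scaledDiscPolynomial m (a - k) (b - k) w /
      (k.factorial * (a + b + m - k + 1).factorial) = ∑ j ∈ range (L + 1 - k), f k j := by
    intro k hk
    have hk' : k ≤ a ∧ k ≤ b := by rw [mem_range] at hk; omega
    rw [scaledDiscPolynomial, sum_div, show min (a - k) (b - k) + 1 = L + 1 - k by omega]
    refine sum_congr rfl fun j _ => ?_
    simp only [f]
    rw [show a - k + (b - k) + m - j = a + b + m - k - (k + j) by omega, Nat.sub_sub a, Nat.sub_sub b,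
      Nat.cast_sub hk'.1, Nat.cast_sub hk'.2]
    push_cast
    simp only [div_eq_mul_inv, mul_inv]
    ring
  -- The powers of w and w̄ depend only on l = k + j. The diagonal l = 0 gives the monomial, and
  -- each l > 0 contributes a vanishing alternating sum.
  rw [sum_congr rfl h1, ← sum_range_diag_flip, sum_range_succ', sum_eq_zero, zero_add]
  · have h0 : ∀ k : ℕ, (k.factorial : ℂ) ≠ 0 := fun k => Nat.cast_ne_zero.2 k.factorial_ne_zero
    have h2 := h0 (a + b + m)
    have h3 : ((a + b + m : ℕ) : ℂ) + 1 ≠ 0 := Nat.cast_add_one_ne_zero _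
    simp only [f, zero_add, sum_range_one, Nat.factorial_succ]
    push_cast at *
    simp
    field_simp
  · intro l hl
    have hl' : l + 1 ≤ a ∧ l + 1 ≤ b := by rw [mem_range] at hl; omega
    have h2 := sum_alternating_eq_zero (M := a + b + m) (Nat.succ_ne_zero l) (by omega)
    rw [← zero_mul (w ^ (a - (l + 1)) * star w ^ (b - (l + 1)) /
      ((a - (l + 1)).factorial * (b - (l + 1)).factorial)), ← h2, sum_mul]
    refine sum_congr rfl fun k hk => ?_
    rw [mem_range] at hk
    simp only [f]
    rw [show k + (l + 1 - k) = l + 1 by omega]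

/-- Each term has 1/((p-j)! (q-j)! j!) = C(p,j) C(q,j) j!/(p! q!). The j! is absorbed by (p+q+m-j)!
j! ≤ (p+q+m)!, C(p,j) is at most 2^p, and the C(q,j) sum to at most 2^q. -/
theorem norm_scaledDiscPolynomial_div_le (m p q : ℕ) {w : ℂ} (hw : ‖w‖ ≤ 1) :
    ‖scaledDiscPolynomial m p q w‖ / (p + q + m + 1).factorial ≤
      (2 ^ p / p.factorial) * (2 ^ q / q.factorial) := by
  have hf : ∀ k : ℕ, (0 : ℝ) < k.factorial := fun k => Nat.cast_pos.2 k.factorial_pos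
  have h1 : ∀ j ∈ range (min p q + 1), ‖((p : ℂ) + q + m + 1) *
      ((-1) ^ j * (p + q + m - j).factorial /
        ((p - j).factorial * (q - j).factorial * j.factorial)) *
        (w ^ (p - j) * star w ^ (q - j))‖ ≤
      (p + q + m + 1).factorial * ((2 ^ p / p.factorial) * (q.choose j / q.factorial)) := by
    intro j hj
    have hj' : j ≤ p ∧ j ≤ q := by rw [mem_range] at hj; omega
    have hw' : ‖w ^ (p - j) * star w ^ (q - j)‖ ≤ 1 := by
      rw [norm_mul, norm_pow, norm_pow, norm_star]
      exact mul_le_one₀ (pow_le_one₀ (norm_nonneg _) hw) (by positivity)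
        (pow_le_one₀ (norm_nonneg _) hw)
    have hn : ‖((p : ℂ) + q + m + 1)‖ = p + q + m + 1 := by
      rw [show ((p : ℂ) + q + m + 1) = ((p + q + m + 1 : ℕ) : ℂ) by push_cast; rfl,
        Complex.norm_natCast]
      push_cast; rfl
    rw [norm_mul, norm_mul, hn, norm_div, norm_mul, norm_mul, norm_mul, norm_pow, norm_neg,
      norm_one, one_pow, one_mul]
    simp only [Complex.norm_natCast]
    refine (mul_le_of_le_one_right (by positivity) hw').trans ?_
    have e1 : (p.choose j : ℝ) ≤ 2 ^ p := by exact_mod_cast Nat.choose_le_two_pow p j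
    have e2 : ((p + q + m - j).factorial : ℝ) * j.factorial ≤ (p + q + m).factorial := by
      exact_mod_cast Nat.le_of_dvd (Nat.factorial_pos _)
        (mul_comm (p + q + m - j).factorial j.factorial ▸
          Nat.factorial_mul_factorial_dvd_factorial (show j ≤ p + q + m by omega))
    have e3 : (p.choose j : ℝ) * j.factorial * (p - j).factorial = p.factorial := by
      exact_mod_cast Nat.choose_mul_factorial_mul_factorial hj'.1
    have e4 : (q.choose j : ℝ) * j.factorial * (q - j).factorial = q.factorial := by
      exact_mod_cast Nat.choose_mul_factorial_mul_factorial hj'.2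
    have hcp : (0 : ℝ) < p.choose j := Nat.cast_pos.2 (Nat.choose_pos hj'.1)
    have hcq : (0 : ℝ) < q.choose j := Nat.cast_pos.2 (Nat.choose_pos hj'.2)
    calc _ = ((p : ℝ) + q + m + 1) * ((p + q + m - j).factorial * j.factorial) *
          ((p.choose j / p.factorial) * (q.choose j / q.factorial)) := by
          rw [← e3, ← e4]
          have := hf j
          have := hf (p - j)
          have := hf (q - j)
          field_simp
      _ ≤ ((p : ℝ) + q + m + 1) * (p + q + m).factorial *
          ((2 ^ p / p.factorial) * (q.choose j / q.factorial)) := by gcongr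
      _ = _ := by rw [Nat.factorial_succ]; push_cast; ring
  rw [div_le_iff₀ (hf _), scaledDiscPolynomial]
  refine (norm_sum_le_of_le _ h1).trans ?_
  rw [← mul_sum, ← mul_sum, ← sum_div, mul_comm]
  have h2 : ∑ j ∈ range (min p q + 1), (q.choose j : ℝ) ≤ 2 ^ q := by
    rw [← Nat.cast_sum]
    refine (Nat.cast_le.2 (sum_le_sum_of_subset (range_subset_range.2
      (Nat.succ_le_succ (min_le_right p q))))).trans ?_
    rw [Nat.sum_range_choose]
    simp
  gcongr

end PlaneWave

/-! ### Bessel power series and summation of the expansion -/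

namespace PlaneWave

/-- The entire function `(r/2)^{-n+1} J_{l+n-1}(r)` with `n = m + 2`, as a power series. -/
noncomputable def besselSeries (m l : ℕ) (r : ℝ) : ℝ :=
  ∑' k : ℕ, (r / 2) ^ l * ((-1) ^ k / (k.factorial * (k + l + m + 1).factorial) *
    (r / 2) ^ (2 * k))

/-- The factor 1/(l+m+1)! is kept because it must offset the growth of the disc polynomials. -/
theorem norm_besselSeries_term_le (m l k : ℕ) {r R : ℝ} (hr : |r| ≤ R) :
    ‖(r / 2) ^ l * ((-1) ^ k / (k.factorial * (k + l + m + 1).factorial) * (r / 2) ^ (2 * k))‖ ≤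
      (R / 2) ^ l / (l + m + 1).factorial * (((R / 2) ^ 2) ^ k / k.factorial) := by
  have h1 : ((l + m + 1).factorial : ℝ) ≤ (k + l + m + 1).factorial := by
    exact_mod_cast Nat.factorial_le (by omega)
  have h2 : |r| / 2 ≤ R / 2 := by linarith
  have hf : ∀ k : ℕ, (0 : ℝ) < k.factorial := fun k => Nat.cast_pos.2 k.factorial_pos
  rw [norm_mul, norm_mul, norm_div, norm_mul, norm_pow, norm_pow, norm_pow, norm_div, norm_neg,
    norm_one, one_pow, Real.norm_natCast, Real.norm_natCast, Real.norm_eq_abs, Real.norm_two,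
    pow_mul]
  calc _ = (|r| / 2) ^ l * (((|r| / 2) ^ 2) ^ k / (k.factorial * (k + l + m + 1).factorial)) := by
        ring
    _ ≤ (R / 2) ^ l * (((R / 2) ^ 2) ^ k / (k.factorial * (l + m + 1).factorial)) := by
        have := hf k
        have := hf (l + m + 1)
        have : 0 ≤ R := (abs_nonneg r).trans hr
        gcongr
    _ = _ := by
        have := hf k
        have := hf (l + m + 1)
        field_simp

theorem summable_besselSeries_majorant (m l : ℕ) (R : ℝ) : Summable fun k : ℕ =>
    (R / 2) ^ l / (l + m + 1).factorial * (((R / 2) ^ 2) ^ k / k.factorial) :=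
  (Real.summable_pow_div_factorial _).mul_left _

theorem hasSum_besselSeries (m l : ℕ) (r : ℝ) :
    HasSum (fun k : ℕ => (r / 2) ^ l * ((-1) ^ k / (k.factorial * (k + l + m + 1).factorial) *
      (r / 2) ^ (2 * k))) (besselSeries m l r) :=
  (Summable.of_norm_bounded (summable_besselSeries_majorant m l |r|)
    fun k => norm_besselSeries_term_le m l k le_rfl).hasSum

theorem norm_besselSeries_le (m l : ℕ) {r R : ℝ} (hr : |r| ≤ R) :
    ‖besselSeries m l r‖ ≤ (R / 2) ^ l / (l + m + 1).factorial * Real.exp ((R / 2) ^ 2) := by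
  refine (tsum_of_norm_bounded (summable_besselSeries_majorant m l R).hasSum
    fun k => norm_besselSeries_term_le m l k hr).trans ?_
  rw [tsum_mul_left, Real.exp_eq_exp_ℝ, NormedSpace.exp_eq_tsum_div]

theorem continuousAt_besselSeries_zero (m l : ℕ) : ContinuousAt (besselSeries m l) 0 := by
  have h : ContinuousOn (besselSeries m l) (Set.Icc (-1) 1) :=
    continuousOn_tsum (fun k => by fun_prop) (summable_besselSeries_majorant m l 1)
      fun k r hr => norm_besselSeries_term_le m l k (abs_le.2 hr)
  exact h.continuousAt (Icc_mem_nhds (by norm_num) (by norm_num))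

theorem zpow_mul_besselJ (m l : ℕ) {r : ℝ} (hr : 0 < r) :
    (r / 2) ^ (-((m + 2 : ℕ) : ℤ) + 1) * besselJ ((l : ℝ) + (m + 2 : ℕ) - 1) r =
      besselSeries m l r := by
  have hr' : 0 < r / 2 := by linarith
  have e : (r / 2) ^ (-((m + 2 : ℕ) : ℤ) + 1) * (r / 2) ^ ((l : ℝ) + (m + 2 : ℕ) - 1)
      = (r / 2) ^ l := by
    rw [← Real.rpow_intCast, ← Real.rpow_add hr', ← Real.rpow_natCast]
    congr 1; push_cast; ring
  rw [besselJ, ← mul_assoc, e, besselSeries, tsum_mul_left]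
  congr 1
  refine tsum_congr fun k => ?_
  rw [Real.Gamma_nat_eq_factorial, show (k : ℝ) + ((l : ℝ) + (m + 2 : ℕ) - 1) + 1 =
    ((k + l + m + 1 : ℕ) : ℝ) + 1 by push_cast; ring, Real.Gamma_nat_eq_factorial]

/-- At r = 0 both sides are the right-hand limit of the same function. -/
theorem besselCoeff_eq_besselSeries (m l : ℕ) {r : ℝ} (hr : 0 ≤ r) :
    besselCoeff (m + 2) l r = besselSeries m l r := by
  rcases hr.eq_or_lt with rfl | hr
  · refine tendsto_nhds_unique (tendsto_besselCoeff (by omega) l) ?_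
    refine ((continuousAt_besselSeries_zero m l).tendsto.mono_left nhdsWithin_le_nhds).congr' ?_
    filter_upwards [self_mem_nhdsWithin] with r hr
    exact (zpow_mul_besselJ m l hr).symm
  · rw [besselCoeff, Function.update_of_ne hr.ne', zpow_mul_besselJ m l hr]

/-- The terms of the plane wave expansion, with the Bessel functions expanded in power series. -/
noncomputable def planeWaveTerm (m : ℕ) (r : ℝ) (w : ℂ) (x : (ℕ × ℕ) × ℕ) : ℂ :=
  Complex.I ^ (x.1.1 + x.1.2) * ((((r / 2) ^ (x.1.1 + x.1.2) * ((-1) ^ x.2 /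
    (x.2.factorial * (x.2 + (x.1.1 + x.1.2) + m + 1).factorial) *
      (r / 2) ^ (2 * x.2)) : ℝ)) : ℂ) * scaledDiscPolynomial m x.1.1 x.1.2 w

/-- Absorbing (-1)^k = i^{2k} leaves a power that depends only on a + b, where a = p + k and b = q +
k. -/
theorem planeWaveTerm_eq (m : ℕ) (r : ℝ) (w : ℂ) (p q k : ℕ) :
    planeWaveTerm m r w ((p, q), k) = (Complex.I * r / 2) ^ (p + q + 2 * k) *
      (scaledDiscPolynomial m p q w / (k.factorial * (k + (p + q) + m + 1).factorial)) := by
  have h : (Complex.I * r / 2) ^ (p + q + 2 * k) =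
      Complex.I ^ (p + q) * (-1) ^ k * ((r : ℂ) / 2) ^ (p + q) * ((r : ℂ) / 2) ^ (2 * k) := by
    rw [mul_div_assoc, mul_pow, pow_add, pow_mul Complex.I, Complex.I_sq, pow_add ((r : ℂ) / 2)]
    ring
  rw [planeWaveTerm, h]
  push_cast
  ring

/-- The majorant of the terms of the plane wave expansion on the ball of radius `R`. -/
noncomputable def planeWaveMajorant (R : ℝ) (x : ℕ × ℕ) : ℝ :=
  (R ^ x.1 / x.1.factorial) * (R ^ x.2 / x.2.factorial)

theorem summable_planeWaveMajorant (R : ℝ) : Summable (planeWaveMajorant R) :=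
  summable_mul_of_summable_norm (Real.summable_pow_div_factorial R).norm
    (Real.summable_pow_div_factorial R).norm

theorem pow_div_factorial_mul_norm_scaledDiscPolynomial_le (m p q : ℕ) {R : ℝ} (hR : 0 ≤ R) {w : ℂ}
    (hw : ‖w‖ ≤ 1) : (R / 2) ^ (p + q) / (p + q + m + 1).factorial *
      ‖scaledDiscPolynomial m p q w‖ ≤ planeWaveMajorant R (p, q) := by
  calc _ = (R / 2) ^ (p + q) * (‖scaledDiscPolynomial m p q w‖ / (p + q + m + 1).factorial) := by
        ring
    _ ≤ (R / 2) ^ (p + q) * ((2 ^ p / p.factorial) * (2 ^ q / q.factorial)) := by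
        gcongr
        exact norm_scaledDiscPolynomial_div_le m p q hw
    _ = _ := by
        rw [planeWaveMajorant, pow_add, div_pow, div_pow]
        field_simp

theorem summable_planeWaveTerm (m : ℕ) {r : ℝ} {w : ℂ} (hw : ‖w‖ ≤ 1) :
    Summable (planeWaveTerm m r w) := by
  refine Summable.of_norm_bounded (g := fun x => planeWaveMajorant |r| x.1 *
    (((|r| / 2) ^ 2) ^ x.2 / x.2.factorial))
    ((summable_planeWaveMajorant |r|).mul_of_nonneg (Real.summable_pow_div_factorial _) ?_ ?_) ?_
  · intro x
    simp only [planeWaveMajorant]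
    positivity
  · intro k
    positivity
  · rintro ⟨⟨p, q⟩, k⟩
    rw [planeWaveTerm, norm_mul, norm_mul, norm_pow, Complex.norm_I, one_pow, one_mul,
      Complex.norm_real]
    refine (mul_le_mul_of_nonneg_right (norm_besselSeries_term_le m (p + q) k le_rfl)
      (norm_nonneg _)).trans ?_
    rw [mul_right_comm]
    gcongr
    exact pow_div_factorial_mul_norm_scaledDiscPolynomial_le m p q (abs_nonneg r) hw

theorem hasSum_exp_mul_exp (u v : ℂ) : HasSum
    (fun x : ℕ × ℕ => u ^ x.1 / x.1.factorial * (v ^ x.2 / x.2.factorial))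
    (Complex.exp u * Complex.exp v) := by
  have h : ∀ u : ℂ, HasSum (fun k : ℕ => u ^ k / k.factorial) (Complex.exp u) := fun u => by
    rw [Complex.exp_eq_exp_ℂ]
    exact NormedSpace.expSeries_div_hasSum_exp u
  have hn : ∀ u : ℂ, Summable (fun k : ℕ => ‖u ^ k / k.factorial‖) := fun u =>
    NormedSpace.norm_expSeries_div_summable u
  exact HasSum.mul (f := fun k : ℕ => u ^ k / k.factorial) (g := fun k : ℕ => v ^ k / k.factorial)
    (h u) (h v) (summable_mul_of_summable_norm (f := fun k : ℕ => u ^ k / k.factorial)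
      (g := fun k : ℕ => v ^ k / k.factorial) (hn u) (hn v))

/-- Absolute convergence allows the triple series to be summed over k at fixed (a, b) = (p+k, q+k),
where the monomial expansion applies. -/
theorem hasSum_planeWaveTerm (m : ℕ) (r : ℝ) {w : ℂ} (hw : ‖w‖ ≤ 1) :
    HasSum (planeWaveTerm m r w) (Complex.exp (Complex.I * ((r * w).re : ℂ))) := by
  obtain ⟨s, hs⟩ := summable_planeWaveTerm m (r := r) hw
  let φ : (ℕ × ℕ) × ℕ → (ℕ × ℕ) × ℕ := fun x => ((x.1.1 + x.2, x.1.2 + x.2), x.2)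
  have hφ : Function.Injective φ := by
    rintro ⟨⟨p, q⟩, k⟩ ⟨⟨p', q'⟩, k'⟩ h
    simp only [φ, Prod.mk.injEq] at h ⊢
    omega
  -- The reindexed family, extended by zero off the range of `φ`, where k > min(a, b).
  let H : (ℕ × ℕ) × ℕ → ℂ := fun x => if x.2 ∈ Finset.range (min x.1.1 x.1.2 + 1) then
    planeWaveTerm m r w ((x.1.1 - x.2, x.1.2 - x.2), x.2) else 0
  have hH : HasSum H s := by
    refine (hφ.hasSum_iff ?_).1 ?_
    · rintro ⟨⟨a, b⟩, k⟩ hx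
      refine if_neg fun hk => hx ⟨((a - k, b - k), k), ?_⟩
      simp only [Finset.mem_range, φ, Prod.mk.injEq, and_true] at hk ⊢
      omega
    · convert hs using 1
      funext ⟨⟨p, q⟩, k⟩
      simp [H, φ]
  have hfib : ∀ x : ℕ × ℕ, HasSum (fun k => H (x, k))
      ((Complex.I * r / 2 * w) ^ x.1 / x.1.factorial *
        ((Complex.I * r / 2 * star w) ^ x.2 / x.2.factorial)) := by
    rintro ⟨a, b⟩
    have h1 : ∀ k ∈ Finset.range (min a b + 1), H ((a, b), k) = (Complex.I * r / 2) ^ (a + b) *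
        (scaledDiscPolynomial m (a - k) (b - k) w /
          (k.factorial * (a + b + m - k + 1).factorial)) := by
      intro k hk
      rw [show H ((a, b), k) = _ from if_pos hk, planeWaveTerm_eq]
      rw [Finset.mem_range] at hk
      rw [show a - k + (b - k) + 2 * k = a + b by omega,
        show k + (a - k + (b - k)) + m + 1 = a + b + m - k + 1 by omega]
    convert hasSum_sum_of_ne_finset_zero (f := fun k => H ((a, b), k))
      (s := Finset.range (min a b + 1)) (fun k hk => if_neg hk) using 1
    swap
    · infer_instance
    rw [Finset.sum_congr rfl h1, ← Finset.mul_sum, sum_scaledDiscPolynomial, mul_pow, mul_pow,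
      pow_add]
    ring
  have h2 := (hH.prod_fiberwise hfib).unique (hasSum_exp_mul_exp _ _)
  have h3 : Complex.I * ((r * w).re : ℂ) =
      Complex.I * r / 2 * w + Complex.I * r / 2 * star w := by
    rw [Complex.re_eq_add_conj, map_mul, Complex.conj_ofReal, RCLike.star_def]
    ring
  rw [h3, Complex.exp_add, ← h2]
  exact hs

/-- The same triple series, now summed over k at fixed (p, q). -/
theorem hasSum_planeWave (m : ℕ) (r : ℝ) {w : ℂ} (hw : ‖w‖ ≤ 1) :
    HasSum (fun x : ℕ × ℕ => Complex.I ^ (x.1 + x.2) * (besselSeries m (x.1 + x.2) r : ℂ) *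
      scaledDiscPolynomial m x.1 x.2 w) (Complex.exp (Complex.I * ((r * w).re : ℂ))) := by
  refine HasSum.prod_fiberwise (hasSum_planeWaveTerm m r hw) fun x => ?_
  simp only [planeWaveTerm]
  exact ((Complex.hasSum_ofReal.2 (hasSum_besselSeries m (x.1 + x.2) r)).mul_left _).mul_right _

theorem norm_planeWave_term_le (m p q : ℕ) {r R : ℝ} (hr : |r| ≤ R) {w : ℂ} (hw : ‖w‖ ≤ 1) :
    ‖Complex.I ^ (p + q) * (besselSeries m (p + q) r : ℂ) * scaledDiscPolynomial m p q w‖ ≤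
      Real.exp ((R / 2) ^ 2) * planeWaveMajorant R (p, q) := by
  rw [norm_mul, norm_mul, norm_pow, Complex.norm_I, one_pow, one_mul, Complex.norm_real]
  refine (mul_le_mul_of_nonneg_right (norm_besselSeries_le m (p + q) hr) (norm_nonneg _)).trans ?_
  rw [mul_right_comm, mul_comm]
  gcongr
  exact pow_div_factorial_mul_norm_scaledDiscPolynomial_le m p q ((abs_nonneg r).trans hr) hw

end PlaneWave

/-! ### The plane wave expansion -/

theorem mainTheorem4 (n : ℕ) (hn : 2 ≤ n)
    (η : EuclideanSpace ℂ (Fin n)) (hη : ‖η‖ = 1)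
    -- a polar decomposition `x = |x| ξ` with `ξ = ξ x` on the unit sphere
    (ξ : EuclideanSpace ℂ (Fin n) → EuclideanSpace ℂ (Fin n))
    (hξ : ∀ x, ‖ξ x‖ = 1 ∧ x = (‖x‖ : ℂ) • ξ x) :
    -- the expansion, absolutely convergent, at every `x ≠ 0`
    (∀ x : EuclideanSpace ℂ (Fin n), x ≠ 0 →
      Summable (fun pq : ℕ × ℕ => ‖Complex.I ^ (pq.1 + pq.2) *
        (Module.finrank ℂ (PlaneWave.solidHarmonics n pq.1 pq.2) : ℂ) *
        (PlaneWave.besselJ ((pq.1 : ℝ) + pq.2 + n - 1) ‖x‖ : ℂ) *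
        PlaneWave.zonalHarmonic pq.1 pq.2 η (ξ x)‖) ∧
      Complex.exp (Complex.I * ((inner ℂ η x : ℂ).re : ℂ)) =
        ((n - 1).factorial : ℂ) * ((‖x‖ : ℂ) / 2) ^ (-(n : ℤ) + 1) *
          ∑' pq : ℕ × ℕ, Complex.I ^ (pq.1 + pq.2) *
            (Module.finrank ℂ (PlaneWave.solidHarmonics n pq.1 pq.2) : ℂ) *
            (PlaneWave.besselJ ((pq.1 : ℝ) + pq.2 + n - 1) ‖x‖ : ℂ) *
            PlaneWave.zonalHarmonic pq.1 pq.2 η (ξ x)) ∧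
    -- with the coefficients extended by continuity to the origin, the expansion holds everywhere
    -- and converges absolutely and uniformly on every ball
    (∀ (c : EuclideanSpace ℂ (Fin n)) (R : ℝ),
      HasSumUniformlyOn
        (fun (pq : ℕ × ℕ) (x : EuclideanSpace ℂ (Fin n)) =>
          ((n - 1).factorial : ℂ) * Complex.I ^ (pq.1 + pq.2) *
            (Module.finrank ℂ (PlaneWave.solidHarmonics n pq.1 pq.2) : ℂ) *
            (PlaneWave.besselCoeff n (pq.1 + pq.2) ‖x‖ : ℂ) *
            PlaneWave.zonalHarmonic pq.1 pq.2 η (ξ x))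
        (fun x => Complex.exp (Complex.I * ((inner ℂ η x : ℂ).re : ℂ)))
        (Metric.closedBall c R) ∧
      SummableUniformlyOn
        (fun (pq : ℕ × ℕ) (x : EuclideanSpace ℂ (Fin n)) =>
          ‖((n - 1).factorial : ℂ) * Complex.I ^ (pq.1 + pq.2) *
            (Module.finrank ℂ (PlaneWave.solidHarmonics n pq.1 pq.2) : ℂ) *
            (PlaneWave.besselCoeff n (pq.1 + pq.2) ‖x‖ : ℂ) *
            PlaneWave.zonalHarmonic pq.1 pq.2 η (ξ x)‖)
        (Metric.closedBall c R)) := by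
  obtain ⟨m, rfl⟩ : ∃ m, n = m + 2 := ⟨n - 2, by omega⟩
  have hw : ∀ x, ‖(inner ℂ η (ξ x) : ℂ)‖ ≤ 1 := fun x => by
    simpa [hη, (hξ x).1] using norm_inner_le_norm (𝕜 := ℂ) η (ξ x)
  have hinner : ∀ x, (inner ℂ η x : ℂ) = (‖x‖ : ℂ) * inner ℂ η (ξ x) := fun x => by
    conv_lhs => rw [(hξ x).2]
    rw [inner_smul_right]
  have hterm : ∀ (pq : ℕ × ℕ) (x : EuclideanSpace ℂ (Fin (m + 2))),
      ((m + 2 - 1).factorial : ℂ) * Complex.I ^ (pq.1 + pq.2) *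
        (Module.finrank ℂ (PlaneWave.solidHarmonics (m + 2) pq.1 pq.2) : ℂ) *
        (PlaneWave.besselCoeff (m + 2) (pq.1 + pq.2) ‖x‖ : ℂ) *
        PlaneWave.zonalHarmonic pq.1 pq.2 η (ξ x) =
      Complex.I ^ (pq.1 + pq.2) * (PlaneWave.besselSeries m (pq.1 + pq.2) ‖x‖ : ℂ) *
        PlaneWave.scaledDiscPolynomial m pq.1 pq.2 (inner ℂ η (ξ x)) := fun pq x => by
    rw [PlaneWave.besselCoeff_eq_besselSeries m _ (norm_nonneg x), PlaneWave.zonalHarmonic,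
      ← PlaneWave.factorial_mul_finrank_mul_discPolynomial,
      show (((m + 2 : ℕ) : ℂ) - 2) = m by push_cast; ring, show m + 2 - 1 = m + 1 by omega]
    ring
  have hsum : ∀ x : EuclideanSpace ℂ (Fin (m + 2)), HasSum (fun pq : ℕ × ℕ =>
      ((m + 2 - 1).factorial : ℂ) * Complex.I ^ (pq.1 + pq.2) *
        (Module.finrank ℂ (PlaneWave.solidHarmonics (m + 2) pq.1 pq.2) : ℂ) *
        (PlaneWave.besselCoeff (m + 2) (pq.1 + pq.2) ‖x‖ : ℂ) *
        PlaneWave.zonalHarmonic pq.1 pq.2 η (ξ x))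
      (Complex.exp (Complex.I * ((inner ℂ η x : ℂ).re : ℂ))) := fun x => by
    simp only [hterm]
    rw [hinner x]
    exact PlaneWave.hasSum_planeWave m ‖x‖ (hw x)
  have hbound : ∀ (R : ℝ) (pq : ℕ × ℕ) (x : EuclideanSpace ℂ (Fin (m + 2))), ‖x‖ ≤ R →
      ‖((m + 2 - 1).factorial : ℂ) * Complex.I ^ (pq.1 + pq.2) *
        (Module.finrank ℂ (PlaneWave.solidHarmonics (m + 2) pq.1 pq.2) : ℂ) *
        (PlaneWave.besselCoeff (m + 2) (pq.1 + pq.2) ‖x‖ : ℂ) *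
        PlaneWave.zonalHarmonic pq.1 pq.2 η (ξ x)‖ ≤
      Real.exp ((R / 2) ^ 2) * PlaneWave.planeWaveMajorant R pq := fun R pq x hx => by
    rw [hterm]
    exact PlaneWave.norm_planeWave_term_le m pq.1 pq.2 (by rwa [abs_norm]) (hw x)
  have hmaj : ∀ R : ℝ, Summable fun pq =>
      Real.exp ((R / 2) ^ 2) * PlaneWave.planeWaveMajorant R pq := fun R =>
    (PlaneWave.summable_planeWaveMajorant R).mul_left _
  refine ⟨fun x hx => ?_, fun c R => ?_⟩
  · have hr : 0 < ‖x‖ := norm_pos_iff.2 hx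
    -- For x ≠ 0 this constant is nonzero, so it can be pulled out of the sum without affecting
    -- summability.
    set C : ℂ := ((m + 2 - 1).factorial : ℂ) * ((‖x‖ : ℂ) / 2) ^ (-((m + 2 : ℕ) : ℤ) + 1) with hC
    have hC0 : C ≠ 0 := by
      have h1 : ((‖x‖ : ℂ) / 2) ≠ 0 :=
        div_ne_zero (Complex.ofReal_ne_zero.2 hr.ne') two_ne_zero
      exact mul_ne_zero (Nat.cast_ne_zero.2 (Nat.factorial_ne_zero _)) (zpow_ne_zero _ h1)
    have hrel : ∀ pq : ℕ × ℕ, ((m + 2 - 1).factorial : ℂ) * Complex.I ^ (pq.1 + pq.2) *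
        (Module.finrank ℂ (PlaneWave.solidHarmonics (m + 2) pq.1 pq.2) : ℂ) *
        (PlaneWave.besselCoeff (m + 2) (pq.1 + pq.2) ‖x‖ : ℂ) *
        PlaneWave.zonalHarmonic pq.1 pq.2 η (ξ x) = C * (Complex.I ^ (pq.1 + pq.2) *
        (Module.finrank ℂ (PlaneWave.solidHarmonics (m + 2) pq.1 pq.2) : ℂ) *
        (PlaneWave.besselJ ((pq.1 : ℝ) + pq.2 + (m + 2 : ℕ) - 1) ‖x‖ : ℂ) *
        PlaneWave.zonalHarmonic pq.1 pq.2 η (ξ x)) := fun pq => by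
      rw [PlaneWave.besselCoeff_eq_besselSeries m _ hr.le, ← PlaneWave.zpow_mul_besselJ m _ hr, hC]
      push_cast
      ring
    have hs := hsum x
    have hn := Summable.of_nonneg_of_le (fun _ => norm_nonneg _)
      (fun pq => hbound ‖x‖ pq x le_rfl) (hmaj ‖x‖)
    simp only [hrel] at hs hn
    constructor
    · simp only [norm_mul C] at hn
      exact (summable_mul_left_iff (norm_ne_zero_iff.2 hC0)).1 hn
    · rw [← tsum_mul_left]
      exact hs.tsum_eq.symm
  -- The majorant is for balls about the origin; enlarging the radius to ‖c‖ + R covers any ball,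
  -- and the Weierstrass M-test applies.
  · have hR : ∀ x ∈ Metric.closedBall c R, ‖x‖ ≤ ‖c‖ + R := fun x hx => by
      have h1 := norm_le_norm_add_norm_sub' x c
      have h2 := mem_closedBall_iff_norm.1 hx
      linarith
    constructor
    · exact (HasSumUniformlyOn.of_norm_le_summable (hmaj (‖c‖ + R))
        fun pq x hx => hbound _ pq x (hR x hx)).congr_right fun x _ => (hsum x).tsum_eq
    · refine (HasSumUniformlyOn.of_norm_le_summable (hmaj (‖c‖ + R))
        fun pq x hx => ?_).summableUniformlyOn
      rw [norm_norm]
      exact hbound _ pq x (hR x hx)
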